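/- Let $n,m,d\ge 1$ be integers, $T>0$, $x_0,x_T\in\mathbb{R}^n$, and let $\mathrm{U}\subset\mathbb{R}^m$ be nonempty, closed and convex. Let $f:\mathbb{R}^n\times\mathbb{R}^m\times[0,T]\to\mathbb{R}^n$ be of class $\mathrm{C}^2$, let $F:\mathbb{R}^n\times\mathbb{R}^m\times[0,T]\to\mathbb{R}^d$ be continuous and differentiable with respect to its first variable with $\nabla_x F$ continuous, and let $\Lambda\subset\mathbb{R}^d$ be closed with $0\in\Lambda$. Let $\mathcal{A}$ be the set of pairs $(x,u)$ with $x:[0,T]\to\mathbb{R}^n$ absolutely continuous, $u\in\mathrm{L}^\infty([0,T],\mathbb{R}^m)$, $u(t)\in\mathrm{U}$ and $\dot x(t)=f(x(t),u(t),t)$ for a.e. $t\in[0,T]$, $x(0)=x_0$ and $x(T)=x_T$. Let $\mathcal{U}$ be the set of all $u\in\mathrm{L}^1([0,T],\mathbb{R}^m)$ for which the Cauchy problem $\dot x(t)=f(x(t),u(t),t)$ for a.e. $t\in[0,T]$, $x(0)=x_0$, has a unique absolutely continuous solution on $[0,T]$, denoted by $x(\cdot,u)$, and let $\mathcal{U}_{\mathrm{adm}}:=\{u\in\mathcal{U}\mid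 (x(\cdot,u),u)\in\mathcal{A}\}$. Assume that $\mathcal{A}\neq\emptyset$, that $\mathrm{U}$ is compact, that there exists $R>0$ such that $\sup_{t\in[0,T]}\Vert x(t)\Vert\le R$ for all $(x,u)\in\mathcal{A}$, and that for all $(x,t)\in\mathbb{R}^n\times[0,T]$ the set $$\{(f(x,u,t),F(x,u,t)+\lambda)\mid (u,\lambda)\in\mathrm{U}\times\Lambda\}\subset\mathbb{R}^n\times\mathbb{R}^d$$ is convex. Then every sequence $(u_k)_{k\in\mathbb{N}}$ in $\mathcal{U}_{\mathrm{adm}}$ has a subsequence (not relabeled) for which there exist $\overline{u}\in\mathcal{U}_{\mathrm{adm}}$ and $\overline{\lambda}\in\mathrm{L}^\infty([0,T],\mathbb{R}^d)$ with $\overline{\lambda}(t)\in\Lambda$ for a.e. $t\in[0,T]$ such that: (i) $x(\cdot,u_k)$ converges uniformly on $[0,T]$ to $x(\cdot,\overline{u})$; (ii) $f(x(\cdot,u_k),u_k,\cdot)$ converges weakly-star in $\mathrm{L}^\infty([0,T],\mathbb{R}^n)$ to $f(x(\cdot,\overline{u}),\overline{u},\cdot)$; (iii) $F(x(\cdot,u_k),u_k,\cdot)$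 converges weakly-star in $\mathrm{L}^\infty([0,T],\mathbb{R}^d)$ to $F(x(\cdot,\overline{u}),\overline{u},\cdot)+\overline{\lambda}$. -/

import Mathlib

open MeasureTheory Set Filter Topology

/-- Data of a fixed-endpoint control problem on `[0, T]` with state space `ℝⁿ`, control
constraint set `U ⊆ ℝᵐ` and dynamics `f (x, u, t)`, only used for `t ∈ [0, T]`. -/
structure ControlProblem (n m : ℕ) where
  /-- final time -/
  T : ℝ
  /-- initial state -/
  x₀ : EuclideanSpace ℝ (Fin n)
  /-- final state -/
  xT : EuclideanSpace ℝ (Fin n)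
  /-- control constraint set -/
  U : Set (EuclideanSpace ℝ (Fin m))
  /-- dynamics -/
  f : EuclideanSpace ℝ (Fin n) → EuclideanSpace ℝ (Fin m) → ℝ → EuclideanSpace ℝ (Fin n)

namespace ControlProblem

variable {n m : ℕ} (P : ControlProblem n m)

/-- Lebesgue measure on `[0, T]`. -/
noncomputable def μ : Measure ℝ := volume.restrict (Icc 0 P.T)

/-- `x` is an absolutely continuous solution on `[0, T]` of the forward Cauchy problem
`x' = f (x, u, t)`, `x 0 = x₀`. -/
structure IsSolution (u : ℝ → EuclideanSpace ℝ (Fin m))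
    (x : ℝ → EuclideanSpace ℝ (Fin n)) : Prop where
  absCont : AbsolutelyContinuousOnInterval x 0 P.T
  ode : ∀ᵐ t ∂P.μ, HasDerivAt x (P.f (x t) (u t) t) t
  init : x 0 = P.x₀

/-- The set `𝒰` of controls `u ∈ L¹` for which the Cauchy problem has exactly one solution
on `[0, T]` (trajectories are compared on `[0, T]` only). -/
def UniqueSolControls : Set (ℝ → EuclideanSpace ℝ (Fin m)) :=
  {u | MemLp u 1 P.μ ∧ ∃ x, P.IsSolution u x ∧ ∀ y, P.IsSolution u y → EqOn y x (Icc 0 P.T)}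

open Classical in
/-- The state `x(·, u)`: the solution of the Cauchy problem (zero if there is none).
For `u ∈ 𝒰` its values on `[0, T]` do not depend on the choice. -/
noncomputable def state (u : ℝ → EuclideanSpace ℝ (Fin m)) : ℝ → EuclideanSpace ℝ (Fin n) :=
  if h : ∃ x, P.IsSolution u x then h.choose else 0

/-- `(x, u) ∈ 𝒜`: admissible pairs. -/
structure IsAdmissiblePair (x : ℝ → EuclideanSpace ℝ (Fin n))
    (u : ℝ → EuclideanSpace ℝ (Fin m)) : Prop where
  memLp : MemLp u ⊤ P.μ
  mem_U : ∀ᵐ t ∂P.μ, u t ∈ P.U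
  sol : P.IsSolution u x
  final : x P.T = P.xT

/-- The set `𝒰_adm` of admissible controls. -/
def AdmControls : Set (ℝ → EuclideanSpace ℝ (Fin m)) :=
  {u | u ∈ P.UniqueSolControls ∧ P.IsAdmissiblePair (P.state u) u}

/-- The compactness assumption. -/
def HComp : Prop :=
  IsCompact P.U ∧
    ∃ R > 0, ∀ x u, P.IsAdmissiblePair x u → ∀ t ∈ Icc 0 P.T, ‖x t‖ ≤ R

/-- The extended velocity set
`{ (f (x, u, t), F (x, u, t) + l) | u ∈ U, l ∈ Λ }`. -/
def extVelocity {d : ℕ}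
    (F : EuclideanSpace ℝ (Fin n) → EuclideanSpace ℝ (Fin m) → ℝ → EuclideanSpace ℝ (Fin d))
    (Λ : Set (EuclideanSpace ℝ (Fin d))) (x : EuclideanSpace ℝ (Fin n)) (t : ℝ) :
    Set (EuclideanSpace ℝ (Fin n) × EuclideanSpace ℝ (Fin d)) :=
  {p | ∃ u ∈ P.U, ∃ l ∈ Λ, p = (P.f x u t, F x u t + l)}

/-- Weak-star convergence in `L^∞([0, T], ℝᵏ)`, the dual of `L¹([0, T], ℝᵏ)`; all functions
involved are required to belong to `L^∞`. -/
structure WeakStarTendsto {k : ℕ} (g : ℕ → ℝ → EuclideanSpace ℝ (Fin k))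
    (g' : ℝ → EuclideanSpace ℝ (Fin k)) : Prop where
  memLp : ∀ j, MemLp (g j) ⊤ P.μ
  memLp_lim : MemLp g' ⊤ P.μ
  tendsto : ∀ φ : ℝ → EuclideanSpace ℝ (Fin k), Integrable φ P.μ →
    Tendsto (fun j => ∫ t, inner ℝ (g j t) (φ t) ∂P.μ) atTop
      (𝓝 (∫ t, inner ℝ (g' t) (φ t) ∂P.μ))

end ControlProblem

/-! This is Filippov's compactness argument. Trajectories stay in a ball and controls in a compact
set, so velocities and costs are uniformly bounded. They therefore have weakly convergent
subsequences in the Hilbert space L², with limits `v` and `w`, and the uniform bounds upgrade this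
to weak-star convergence in L^∞ (`tendsto_integral_inner_of_tendsto_weak`). Integrating the
velocities gives pointwise convergence of the states to a primitive `y` of `v`; their common
Lipschitz constant makes it uniform.

The crux is that `(v t, w t)` lies in the extended velocity set at `(y t, t)` for a.e. `t`. Since 0
∈ Λ, the pairs `(f, F)` along the sequence eventually lie in any prescribed thickening of that set.
The thickenings are closed and convex, so by Hahn–Banach the constraint survives weak limits
(`ae_mem_of_tendsto_weak_prod`); shrinking them recovers the set itself, which is closed.

A measurable selection (`exists_measurable_control`) then realises `v` and `w` by a control and a
Λ-valued slack, and a Grönwall argument (`IsSolution.eqOn`) identifies `y` with the state of that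
control. -/

/-- Sequential Banach–Alaoglu in the dual, carried back to `H` by the Riesz isomorphism. -/
theorem exists_subseq_tendsto_weak {H : Type*} [NormedAddCommGroup H] [InnerProductSpace ℝ H]
    [CompleteSpace H] [TopologicalSpace.SeparableSpace H] (g : ℕ → H) {M : ℝ}
    (hM : ∀ k, ‖g k‖ ≤ M) :
    ∃ φ : ℕ → ℕ, StrictMono φ ∧ ∃ G : H, ∀ ℓ : H →L[ℝ] ℝ,
      Tendsto (fun k => ℓ (g (φ k))) atTop (𝓝 (ℓ G)) := by
  have hs := WeakDual.isSeqCompact_closedBall ℝ H 0 M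
  obtain ⟨a, -, φ, hφ, ha⟩ := hs
    (x := fun k => StrongDual.toWeakDual (InnerProductSpace.toDual ℝ H (g k)))
    (fun k => by simpa using hM k)
  refine ⟨φ, hφ, (InnerProductSpace.toDual ℝ H).symm (WeakDual.toStrongDual a), fun ℓ => ?_⟩
  have h := (WeakBilin.tendsto_iff_forall_eval_tendsto _ ContinuousLinearMap.coe_injective).1 ha
    ((InnerProductSpace.toDual ℝ H).symm ℓ)
  have e : ∀ x, ℓ x = inner ℝ x ((InnerProductSpace.toDual ℝ H).symm ℓ) := fun x => by
    rw [real_inner_comm, InnerProductSpace.toDual_symm_apply]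
  simp_rw [e]
  convert h using 2
  · exact (InnerProductSpace.toDual_apply_apply (𝕜 := ℝ)).symm
  · exact InnerProductSpace.toDual_symm_apply

theorem Convex.mem_of_tendsto_weak {H : Type*} [NormedAddCommGroup H] [NormedSpace ℝ H]
    {K : Set H} (hK : Convex ℝ K) (hKc : IsClosed K) {g : ℕ → H} {G : H}
    (h : ∀ ℓ : H →L[ℝ] ℝ, Tendsto (fun k => ℓ (g k)) atTop (𝓝 (ℓ G)))
    (hg : ∀ᶠ k in atTop, g k ∈ K) : G ∈ K := by
  by_contra hG
  obtain ⟨ℓ, s, h1, h2⟩ := geometric_hahn_banach_closed_point hK hKc hG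
  have : ℓ G ≤ s := le_of_tendsto (h ℓ) (hg.mono fun k hk => (h1 _ hk).le)
  linarith

/-! ### Weak limits in L² under pointwise constraints -/

section Lp

variable {α : Type*} [MeasurableSpace α] {μ : Measure α}
  {E F : Type*} [NormedAddCommGroup E] [NormedAddCommGroup F]

theorem convex_setOf_ae_mem_prod [NormedSpace ℝ E] [NormedSpace ℝ F] {Γ : α → Set (E × F)}
    (hΓ : ∀ᵐ t ∂μ, Convex ℝ (Γ t)) :
    Convex ℝ {p : Lp E 2 μ × Lp F 2 μ | ∀ᵐ t ∂μ, (p.1 t, p.2 t) ∈ Γ t} := by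
  intro p hp q hq a b ha hb hab
  filter_upwards [hp, hq, hΓ, Lp.coeFn_add (a • p.1) (b • q.1), Lp.coeFn_add (a • p.2) (b • q.2),
    Lp.coeFn_smul a p.1, Lp.coeFn_smul a p.2, Lp.coeFn_smul b q.1, Lp.coeFn_smul b q.2]
    with t h1 h2 h3 e1 e2 e3 e4 e5 e6
  have := h3 h1 h2 ha hb hab
  change ((a • p.1 + b • q.1 : Lp E 2 μ) t, (a • p.2 + b • q.2 : Lp F 2 μ) t) ∈ Γ t
  simp only [Pi.add_apply, Pi.smul_apply, e3, e4, e5, e6] at e1 e2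
  rw [e1, e2]
  exact this

theorem Lp.exists_subseq_tendsto_ae {g : ℕ → Lp E 2 μ} {G : Lp E 2 μ}
    (h : Tendsto g atTop (𝓝 G)) :
    ∃ φ : ℕ → ℕ, StrictMono φ ∧ ∀ᵐ t ∂μ, Tendsto (fun k => g (φ k) t) atTop (𝓝 (G t)) :=
  (tendstoInMeasure_of_tendsto_Lp h).exists_seq_tendsto_ae

theorem isClosed_setOf_ae_mem_prod {Γ : α → Set (E × F)} (hΓ : ∀ᵐ t ∂μ, IsClosed (Γ t)) :
    IsClosed {p : Lp E 2 μ × Lp F 2 μ | ∀ᵐ t ∂μ, (p.1 t, p.2 t) ∈ Γ t} := by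
  refine IsSeqClosed.isClosed fun g G hg hG => ?_
  obtain ⟨φ, hφ, h1⟩ := Lp.exists_subseq_tendsto_ae ((continuous_fst.tendsto _).comp hG)
  obtain ⟨ψ, hψ, h2⟩ := Lp.exists_subseq_tendsto_ae
    (((continuous_snd.tendsto _).comp hG).comp hφ.tendsto_atTop)
  have h3 : ∀ᵐ t ∂μ, ∀ k, ((g k).1 t, (g k).2 t) ∈ Γ t := ae_all_iff.2 hg
  filter_upwards [h1, h2, h3, hΓ] with t a1 a2 a3 a4
  exact a4.mem_of_tendsto ((a1.comp hψ.tendsto_atTop).prodMk_nhds a2)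
    (Eventually.of_forall fun k => a3 _)

/-- Closed convex constraints on values define a closed convex set of pairs in L² × L², hence a
weakly closed one. -/
theorem ae_mem_of_tendsto_weak_prod [NormedSpace ℝ E] [NormedSpace ℝ F] {Γ : α → Set (E × F)}
    (hconv : ∀ᵐ t ∂μ, Convex ℝ (Γ t)) (hcl : ∀ᵐ t ∂μ, IsClosed (Γ t))
    {g : ℕ → α → E} {h : ℕ → α → F} (hg : ∀ k, MemLp (g k) 2 μ) (hh : ∀ k, MemLp (h k) 2 μ)
    {G : Lp E 2 μ} {H : Lp F 2 μ}
    (hG : ∀ ℓ : Lp E 2 μ →L[ℝ] ℝ, Tendsto (fun k => ℓ (hg k).toLp) atTop (𝓝 (ℓ G)))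
    (hH : ∀ ℓ : Lp F 2 μ →L[ℝ] ℝ, Tendsto (fun k => ℓ (hh k).toLp) atTop (𝓝 (ℓ H)))
    (hmem : ∀ᶠ k in atTop, ∀ᵐ t ∂μ, (g k t, h k t) ∈ Γ t) :
    ∀ᵐ t ∂μ, (G t, H t) ∈ Γ t := by
  refine (convex_setOf_ae_mem_prod hconv).mem_of_tendsto_weak (isClosed_setOf_ae_mem_prod hcl)
    (g := fun k => ((hg k).toLp, (hh k).toLp)) (G := (G, H)) (fun ℓ => ?_) ?_
  · have e : ∀ p : Lp E 2 μ × Lp F 2 μ, ℓ p = (ℓ.comp (.inl ℝ _ _)) p.1 + (ℓ.comp (.inr ℝ _ _)) p.2 :=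
      fun p => by simp [← map_add]
    simp_rw [e]
    exact (hG _).add (hH _)
  · filter_upwards [hmem] with k hk
    filter_upwards [hk, (hg k).coeFn_toLp, (hh k).coeFn_toLp] with t h1 h2 h3
    simpa [h2, h3] using h1

theorem ae_norm_le_of_tendsto_weak [NormedSpace ℝ E] {g : ℕ → α → E} (hg : ∀ k, MemLp (g k) 2 μ)
    {G : Lp E 2 μ} {M : ℝ}
    (hG : ∀ ℓ : Lp E 2 μ →L[ℝ] ℝ, Tendsto (fun k => ℓ (hg k).toLp) atTop (𝓝 (ℓ G)))
    (hM : ∀ k, ∀ᵐ t ∂μ, ‖g k t‖ ≤ M) : ∀ᵐ t ∂μ, ‖G t‖ ≤ M := by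
  -- `g` fills both slots; the second is left unconstrained.
  have := ae_mem_of_tendsto_weak_prod (μ := μ) (Γ := fun _ => Metric.closedBall (0 : E) M ×ˢ univ)
    (ae_of_all _ fun _ => (convex_closedBall _ _).prod convex_univ)
    (ae_of_all _ fun _ => Metric.isClosed_closedBall.prod isClosed_univ) hg hg hG hG
    (Eventually.of_forall fun k => (hM k).mono fun t ht => by simpa using ht)
  exact this.mono fun t ht => by simpa using ht

/-- Simple functions are L² tests and are dense in L¹; the uniform bound `M` controls the
approximation error for all `k` and for the limit at once. -/
theorem tendsto_integral_inner_of_tendsto_weak [IsFiniteMeasure μ] [InnerProductSpace ℝ E]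
    {g : ℕ → α → E} (hg : ∀ k, MemLp (g k) 2 μ) {G : Lp E 2 μ} {M : ℝ}
    (hG : ∀ ℓ : Lp E 2 μ →L[ℝ] ℝ, Tendsto (fun k => ℓ (hg k).toLp) atTop (𝓝 (ℓ G)))
    (hM : ∀ k, ∀ᵐ t ∂μ, ‖g k t‖ ≤ M) {φ : α → E} (hφ : Integrable φ μ) :
    Tendsto (fun k => ∫ t, inner ℝ (g k t) (φ t) ∂μ) atTop (𝓝 (∫ t, inner ℝ (G t) (φ t) ∂μ)) := by
  have hGM := ae_norm_le_of_tendsto_weak hg hG hM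
  have key : ∀ (a : α → E), AEStronglyMeasurable a μ → (∀ᵐ t ∂μ, ‖a t‖ ≤ M) →
      ∀ b : α → E, Integrable b μ → Integrable (fun t => inner ℝ (a t) (b t)) μ ∧
        |∫ t, inner ℝ (a t) (b t) ∂μ| ≤ |M| * ∫ t, ‖b t‖ ∂μ := by
    intro a ha haM b hb
    have bd : ∀ᵐ t ∂μ, ‖inner ℝ (a t) (b t)‖ ≤ |M| * ‖b t‖ := haM.mono fun t ht =>
      (norm_inner_le_norm _ _).trans (by gcongr; exact ht.trans (le_abs_self _))
    refine ⟨(hb.norm.const_mul |M|).mono' (ha.inner hb.1) bd, ?_⟩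
    rw [← integral_const_mul, ← Real.norm_eq_abs]
    exact norm_integral_le_of_norm_le (hb.norm.const_mul |M|) bd
  rw [Metric.tendsto_atTop]
  intro ε hε
  -- An L¹ error of this size costs at most `ε / 3` after multiplication by `|M|`; the `+ 1` covers
  -- `M = 0`.
  have hδ : 0 < ε / (3 * (|M| + 1)) := by positivity
  obtain ⟨s, hs, hs'⟩ := (memLp_one_iff_integrable.2 hφ).exists_simpleFunc_eLpNorm_sub_lt
    (by simp) (ε := ENNReal.ofReal (ε / (3 * (|M| + 1)))) (by simpa using hδ)
  have hs2 : MemLp s 2 μ := s.memLp_of_isFiniteMeasure _ _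
  have hsi : Integrable s μ := memLp_one_iff_integrable.1 hs'
  have hint : |M| * ∫ t, ‖φ t - s t‖ ∂μ ≤ ε / 3 := by
    have h1 : ∫ t, ‖φ t - s t‖ ∂μ ≤ ε / (3 * (|M| + 1)) := by
      rw [eLpNorm_one_eq_lintegral_enorm] at hs
      change ∫ t, ‖(φ - s) t‖ ∂μ ≤ _
      rw [integral_norm_eq_lintegral_enorm (hφ.sub hsi).1]
      exact ENNReal.toReal_le_of_le_ofReal hδ.le hs.le
    calc |M| * ∫ t, ‖φ t - s t‖ ∂μ ≤ (|M| + 1) * (ε / (3 * (|M| + 1))) := by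
          gcongr; linarith
      _ = ε / 3 := by field_simp
  have diff : ∀ (a : α → E), AEStronglyMeasurable a μ → (∀ᵐ t ∂μ, ‖a t‖ ≤ M) →
      |∫ t, inner ℝ (a t) (φ t) ∂μ - ∫ t, inner ℝ (a t) (s t) ∂μ| ≤ ε / 3 := by
    intro a ha haM
    rw [← integral_sub (key a ha haM _ hφ).1 (key a ha haM _ hsi).1]
    simp_rw [← inner_sub_right]
    exact (key a ha haM _ (hφ.sub hsi)).2.trans hint
  have hlim := hG (innerSL ℝ hs2.toLp)
  have e : ∀ a : Lp E 2 μ, innerSL ℝ hs2.toLp a = ∫ t, inner ℝ (a t) (s t) ∂μ := by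
    intro a
    rw [innerSL_apply_apply, real_inner_comm, L2.inner_def]
    refine integral_congr_ae ?_
    filter_upwards [hs2.coeFn_toLp] with t ht
    rw [ht]
  simp_rw [e] at hlim
  have e2 : ∀ k, ∫ t, inner ℝ ((hg k).toLp (g k) t) (s t) ∂μ = ∫ t, inner ℝ (g k t) (s t) ∂μ :=
    fun k => integral_congr_ae <| (hg k).coeFn_toLp.mono fun t ht => by simp only [ht]
  simp_rw [e2] at hlim
  obtain ⟨N, hN⟩ := Metric.tendsto_atTop.1 hlim (ε / 3) (by positivity)
  refine ⟨N, fun k hk => ?_⟩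
  have h1 := abs_le.1 (diff (g k) (hg k).1 (hM k))
  have h2 := abs_le.1 (diff G (Lp.aestronglyMeasurable G) hGM)
  have h3 := hN k hk
  rw [Real.dist_eq, abs_lt] at h3 ⊢
  constructor <;> linarith

end Lp

/-! ### Measurable selection -/

/-- On a compact set the minimum is attained, so a zero exists iff values on a countable dense
subset get below every `1 / (n + 1)`. -/
theorem IsCompact.measurableSet_exists_eq_zero {α X : Type*} [MeasurableSpace α]
    [PseudoMetricSpace X] {K : Set X} (hK : IsCompact K) {g : α → X → ℝ}
    (hmeas : ∀ x ∈ K, Measurable fun a => g a x) (hcont : ∀ a, ContinuousOn (g a) K)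
    (hnn : ∀ a, ∀ x ∈ K, 0 ≤ g a x) :
    MeasurableSet {a | ∃ x ∈ K, g a x = 0} := by
  obtain ⟨D, hDK, hDc, hD⟩ := hK.isSeparable.exists_countable_dense_subset
  have : {a | ∃ x ∈ K, g a x = 0} = ⋂ n : ℕ, ⋃ x ∈ D, {a | g a x < 1 / ((n : ℝ) + 1)} := by
    ext a
    simp only [mem_ofPred_eq, mem_iInter, mem_iUnion, exists_prop]
    constructor
    · rintro ⟨x, hx, h0⟩ n
      have h1 : ∀ᶠ y in 𝓝[K] x, g a y < 1 / ((n : ℝ) + 1) :=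
        (hcont a x hx).eventually_lt_const (by rw [h0]; positivity)
      have h2 : (𝓝[D] x).NeBot := mem_closure_iff_nhdsWithin_neBot.1 (hD hx)
      obtain ⟨y, hy, hyD⟩ := ((h1.filter_mono (nhdsWithin_mono x hDK)).and
        self_mem_nhdsWithin).exists
      exact ⟨y, hyD, hy⟩
    · intro h
      obtain ⟨y, hy, -⟩ := h 0
      obtain ⟨x, hx, hmin⟩ := hK.exists_isMinOn ⟨y, hDK hy⟩ (hcont a)
      refine ⟨x, hx, le_antisymm (le_of_forall_pos_le_add fun ε hε => ?_) (hnn a x hx)⟩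
      obtain ⟨n, hn⟩ := exists_nat_one_div_lt hε
      obtain ⟨z, hz, hz'⟩ := h n
      have := hmin (hDK hz)
      simp only [mem_ofPred_eq] at this
      linarith
  rw [this]
  exact MeasurableSet.iInter fun n => MeasurableSet.biUnion hDc fun x hx =>
    measurableSet_lt (hmeas x (hDK hx)) measurable_const

/-- Parametrize `K` by the Cantor set, whose order as a subset of ℝ permits choosing the least zero.
That zero is at most `r` iff some zero is at most `r`, a measurable condition by the preceding
lemma. -/
theorem IsCompact.exists_measurable_zero {α X : Type*} [MeasurableSpace α]
    [MetricSpace X] [MeasurableSpace X] [BorelSpace X] {K : Set X} (hK : IsCompact K)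
    (hne : K.Nonempty) {g : α → X → ℝ}
    (hmeas : ∀ x ∈ K, Measurable fun a => g a x) (hcont : ∀ a, ContinuousOn (g a) K)
    (hnn : ∀ a, ∀ x ∈ K, 0 ≤ g a x) (hex : ∀ a, ∃ x ∈ K, g a x = 0) :
    ∃ s : α → X, Measurable s ∧ ∀ a, s a ∈ K ∧ g a (s a) = 0 := by
  have := hne.to_subtype
  have := isCompact_iff_compactSpace.1 hK
  obtain ⟨c, hc, hcs⟩ := exists_nat_bool_continuous_surjective_of_compact K
  let q : cantorSet → X := fun r => c (cantorSetHomeomorphNatToBool r)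
  have hq : Continuous q := continuous_subtype_val.comp (hc.comp (Homeomorph.continuous _))
  have hqK : ∀ r, q r ∈ K := fun r => (c _).2
  have hcomp : CompactSpace cantorSet := isCompact_iff_compactSpace.1 isCompact_cantorSet
  have hgq : ∀ a, Continuous fun r => g a (q r) := fun a =>
    (hcont a).comp_continuous hq hqK
  let S : α → Set cantorSet := fun a => {r | g a (q r) = 0}
  have hS : ∀ a, ∃ r ∈ S a, ∀ r' ∈ S a, (r : ℝ) ≤ r' := by
    intro a
    have hSc : IsCompact (S a) := (isClosed_eq (hgq a) continuous_const).isCompact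
    obtain ⟨x, hx, h0⟩ := hex a
    obtain ⟨b, hb⟩ := hcs ⟨x, hx⟩
    have hSn : (S a).Nonempty := ⟨cantorSetHomeomorphNatToBool.symm b, by
      simp only [S, q, mem_ofPred_eq, Homeomorph.apply_symm_apply, hb, h0]⟩
    obtain ⟨r, hr, hmin⟩ := hSc.exists_isMinOn hSn continuous_subtype_val.continuousOn
    exact ⟨r, hr, fun r' hr' => hmin hr'⟩
  choose m hm hmin using hS
  have hmm : Measurable m := by
    refine (MeasurableEmbedding.subtype_coe
      isClosed_cantorSet.measurableSet).measurable_comp_iff.1 ?_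
    refine measurable_of_Iic fun r => ?_
    have : (Subtype.val ∘ m) ⁻¹' Iic r =
        {a | ∃ y ∈ {y : cantorSet | (y : ℝ) ≤ r}, g a (q y) = 0} := by
      ext a
      simp only [mem_preimage, Function.comp_apply, mem_Iic, mem_ofPred_eq]
      exact ⟨fun h => ⟨m a, h, hm a⟩, fun ⟨y, hy, h0⟩ => (hmin a y h0).trans hy⟩
    rw [this]
    refine IsCompact.measurableSet_exists_eq_zero ?_ (fun y _ => hmeas _ (hqK y))
      (fun a => (hgq a).continuousOn) (fun a y _ => hnn a _ (hqK y))
    exact (isClosed_le continuous_subtype_val continuous_const).isCompact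
  exact ⟨fun a => q (m a), hq.measurable.comp hmm, fun a => ⟨hqK _, hm a⟩⟩

/-! ### Primitives, Grönwall and uniform convergence -/

theorem norm_intervalIntegral_sub_le {E : Type*} [NormedAddCommGroup E] [NormedSpace ℝ E]
    {g : ℝ → E} {a b M : ℝ} (hgi : IntervalIntegrable g volume a b)
    (hM : ∀ᵐ t, t ∈ uIcc a b → ‖g t‖ ≤ M) {s t : ℝ} (hs : s ∈ uIcc a b) (ht : t ∈ uIcc a b) :
    ‖(∫ r in a..t, g r) - ∫ r in a..s, g r‖ ≤ M * |t - s| := by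
  rw [intervalIntegral.integral_interval_sub_left
    (hgi.mono_set (uIcc_subset_uIcc left_mem_uIcc ht))
    (hgi.mono_set (uIcc_subset_uIcc left_mem_uIcc hs))]
  refine intervalIntegral.norm_integral_le_of_norm_le_const_ae ?_
  filter_upwards [hM] with r hr hr'
  exact hr (uIcc_subset_uIcc hs ht (uIoc_subset_uIcc hr'))

theorem absolutelyContinuousOnInterval_intervalIntegral_of_bounded {E : Type*}
    [NormedAddCommGroup E] [NormedSpace ℝ E]
    {g : ℝ → E} {a b M : ℝ} (hgi : IntervalIntegrable g volume a b)
    (hM : ∀ᵐ t, t ∈ uIcc a b → ‖g t‖ ≤ M) :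
    AbsolutelyContinuousOnInterval (fun t => ∫ r in a..t, g r) a b := by
  refine LipschitzOnWith.absolutelyContinuousOnInterval (K := M.toNNReal)
    (LipschitzOnWith.of_dist_le_mul fun t ht s hs => ?_)
  rw [dist_eq_norm, Real.dist_eq]
  refine (norm_intervalIntegral_sub_le hgi hM hs ht).trans ?_
  gcongr
  exact Real.le_coe_toNNReal M

theorem AbsolutelyContinuousOnInterval.eq_add_integral {E : Type*}
    [NormedAddCommGroup E] [NormedSpace ℝ E] [CompleteSpace E]
    {x g : ℝ → E} {a b M : ℝ} (hx : AbsolutelyContinuousOnInterval x a b)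
    (hg : ∀ᵐ t, t ∈ uIcc a b → HasDerivAt x (g t) t) (hgi : IntervalIntegrable g volume a b)
    (hM : ∀ᵐ t, t ∈ uIcc a b → ‖g t‖ ≤ M) {t : ℝ} (ht : t ∈ uIcc a b) :
    x t = x a + ∫ s in a..t, g s := by
  -- The difference from the primitive is absolutely continuous with a.e. zero derivative, hence
  -- constant.
  have hz := hx.sub (absolutelyContinuousOnInterval_intervalIntegral_of_bounded hgi hM)
  obtain ⟨C, hC⟩ := hz.const_of_ae_hasDerivAt_zero <| by
    filter_upwards [hg, hgi.ae_hasDerivAt_integral] with r h1 h2 hr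
    simpa using (h1 hr).sub (h2 hr a left_mem_uIcc)
  have h1 := hC a left_mem_uIcc
  have h2 := hC t ht
  simp only [Pi.sub_apply, intervalIntegral.integral_same, sub_zero] at h1 h2
  rw [h1, ← h2]
  abel

theorem eq_zero_of_le_mul_integral {φ : ℝ → ℝ} {L T : ℝ} (hT : 0 ≤ T)
    (hφ : ContinuousOn φ (Icc 0 T)) (h0 : ∀ t ∈ Icc 0 T, 0 ≤ φ t)
    (h : ∀ t ∈ Icc 0 T, φ t ≤ L * ∫ s in (0 : ℝ)..t, φ s) {t : ℝ} (ht : t ∈ Icc 0 T) :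
    φ t = 0 := by
  -- A continuous extension makes the primitive differentiable everywhere; Grönwall is applied to
  -- that primitive.
  let φ' : ℝ → ℝ := IccExtend hT ((Icc 0 T).domRestrict φ)
  have hφ' : Continuous φ' := hφ.domRestrict.Icc_extend'
  have e : ∀ t ∈ Icc 0 T, φ' t = φ t := fun t ht => IccExtend_of_mem hT _ ht
  have ei : ∀ t ∈ Icc 0 T, ∫ s in (0 : ℝ)..t, φ s = ∫ s in (0 : ℝ)..t, φ' s := fun t ht =>
    intervalIntegral.integral_congr fun s hs => by
      rw [uIcc_of_le ht.1] at hs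
      exact (e s ⟨hs.1, hs.2.trans ht.2⟩).symm
  have hd : ∀ t, HasDerivAt (fun t => ∫ s in (0 : ℝ)..t, φ' s) (φ' t) t := fun t =>
    intervalIntegral.integral_hasDerivAt_right (hφ'.intervalIntegrable _ _)
      hφ'.stronglyMeasurable.stronglyMeasurableAtFilter hφ'.continuousAt
  have hz := eq_zero_of_abs_deriv_le_mul_abs_self_of_eq_zero_right (K := |L|) (a := 0) (b := T)
    (f := fun t => ∫ s in (0 : ℝ)..t, φ' s) (f' := φ')
    (fun t _ => (hd t).continuousAt.continuousWithinAt) (fun t _ => (hd t).hasDerivWithinAt)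
    (by simp) (fun t ht => by
      have ht' := Ico_subset_Icc_self ht
      rw [e t ht', Real.norm_eq_abs, abs_of_nonneg (h0 t ht')]
      refine (h t ht').trans ?_
      rw [ei t ht', Real.norm_eq_abs, ← abs_mul]
      exact le_abs_self _) t ht
  refine le_antisymm ?_ (h0 t ht)
  simpa [ei t ht, hz] using h t ht

/-- A common Lipschitz constant reduces uniform convergence to convergence on a finite net. -/
theorem tendstoUniformlyOn_of_norm_sub_le {E : Type*} [NormedAddCommGroup E]
    {x : ℕ → ℝ → E} {y : ℝ → E} {S : Set ℝ} (hS : IsCompact S) {M : ℝ}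
    (hx : ∀ k, ∀ s ∈ S, ∀ t ∈ S, ‖x k t - x k s‖ ≤ M * |t - s|)
    (h : ∀ t ∈ S, Tendsto (fun k => x k t) atTop (𝓝 (y t))) :
    TendstoUniformlyOn x y atTop S := by
  have hy : ∀ s ∈ S, ∀ t ∈ S, ‖y t - y s‖ ≤ M * |t - s| := fun s hs t ht =>
    le_of_tendsto ((h t ht).sub (h s hs)).norm (Eventually.of_forall fun k => hx k s hs t ht)
  rw [Metric.tendstoUniformlyOn_iff]
  intro ε hε
  obtain ⟨N, hNS, hNf, hN⟩ := hS.finite_cover_balls (e := ε / (3 * (|M| + 1))) (by positivity)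
  have hev : ∀ᶠ k in atTop, ∀ s ∈ N, dist (x k s) (y s) < ε / 3 :=
    (eventually_all_finite hNf).2 fun s hs =>
      Metric.tendsto_nhds.1 (h s (hNS hs)) _ (by positivity)
  filter_upwards [hev] with k hk t ht
  obtain ⟨s, hs, hst⟩ := mem_iUnion₂.1 (hN ht)
  have h1 := hk s hs
  have h4 : M * |t - s| ≤ ε / 3 := by
    rw [Metric.mem_ball, Real.dist_eq] at hst
    calc M * |t - s| ≤ (|M| + 1) * (ε / (3 * (|M| + 1))) := by
          gcongr
          linarith [le_abs_self M]
      _ = ε / 3 := by field_simp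
  have h2 := (hx k s (hNS hs) t ht).trans h4
  have h3 := (hy s (hNS hs) t ht).trans h4
  rw [← dist_eq_norm] at h2 h3
  rw [dist_comm (y t)]
  calc dist (x k t) (y t) ≤ dist (x k t) (x k s) + dist (x k s) (y s) + dist (y s) (y t) :=
        dist_triangle4 _ _ _ _
    _ < ε := by rw [dist_comm (y s)]; linarith

theorem tendsto_setIntegral_of_tendsto_integral_inner {α ι : Type*} [Fintype ι]
    [MeasurableSpace α] {μ : Measure α} [IsFiniteMeasure μ]
    {g : ℕ → α → EuclideanSpace ℝ ι} {G : α → EuclideanSpace ℝ ι}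
    (hg : ∀ k, Integrable (g k) μ) (hG : Integrable G μ)
    (h : ∀ φ : α → EuclideanSpace ℝ ι, Integrable φ μ →
      Tendsto (fun k => ∫ t, inner ℝ (g k t) (φ t) ∂μ) atTop (𝓝 (∫ t, inner ℝ (G t) (φ t) ∂μ)))
    {A : Set α} (hA : MeasurableSet A) :
    Tendsto (fun k => ∫ t in A, g k t ∂μ) atTop (𝓝 (∫ t in A, G t ∂μ)) := by
  classical
  have e : ∀ g : α → EuclideanSpace ℝ ι, Integrable g μ → ∀ c : EuclideanSpace ℝ ι,
      ∫ t, inner ℝ (g t) (A.indicator (fun _ => c) t) ∂μ = inner ℝ c (∫ t in A, g t ∂μ) := by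
    intro g hg c
    rw [← integral_inner hg.integrableOn, ← integral_indicator hA]
    congr 1
    ext t
    by_cases ht : t ∈ A <;> simp [ht, real_inner_comm]
  refine ((PiLp.continuous_toLp 2 _).tendsto _).comp
    (f := fun k => WithLp.ofLp (∫ t in A, g k t ∂μ)) (tendsto_pi_nhds.2 fun i => ?_)
  have := h (A.indicator fun _ => EuclideanSpace.single i 1) ((integrable_const _).indicator hA)
  simp only [e _ (hg _), e _ hG, EuclideanSpace.inner_single_left] at this
  simpa using this

/-! ### Composition with maps continuous only for times in [0, T] -/

section Carath

variable {X Y Z : Type*} [NormedAddCommGroup X] [NormedAddCommGroup Y] [NormedAddCommGroup Z]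
  {T : ℝ} {G : X → Y → ℝ → Z}

theorem continuous_comp_projIcc (hT : 0 ≤ T)
    (hG : ContinuousOn (fun p : X × Y × ℝ => G p.1 p.2.1 p.2.2) (univ ×ˢ univ ×ˢ Icc 0 T))
    {x : ℝ → X} (hx : ContinuousOn x (Icc 0 T)) :
    Continuous fun p : ℝ × Y => G (x (projIcc 0 T hT p.1)) p.2 (projIcc 0 T hT p.1) := by
  have hp : Continuous fun p : ℝ × Y => ((projIcc 0 T hT p.1 : Icc 0 T) : ℝ) :=
    continuous_subtype_val.comp (continuous_projIcc.comp continuous_fst)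
  have hxp : Continuous fun p : ℝ × Y => x (projIcc 0 T hT p.1) :=
    hx.comp_continuous hp fun p => (projIcc 0 T hT p.1).2
  exact hG.comp_continuous (hxp.prodMk (continuous_snd.prodMk hp))
    fun p => ⟨mem_univ _, mem_univ _, (projIcc 0 T hT p.1).2⟩

theorem aestronglyMeasurable_comp_of_continuousOn (hT : 0 ≤ T)
    (hG : ContinuousOn (fun p : X × Y × ℝ => G p.1 p.2.1 p.2.2) (univ ×ˢ univ ×ˢ Icc 0 T))
    {x : ℝ → X} (hx : ContinuousOn x (Icc 0 T)) {u : ℝ → Y}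
    (hu : AEStronglyMeasurable u (volume.restrict (Icc 0 T))) :
    AEStronglyMeasurable (fun t => G (x t) (u t) t) (volume.restrict (Icc 0 T)) := by
  refine ((continuous_comp_projIcc hT hG hx).comp_aestronglyMeasurable
    (aestronglyMeasurable_id.prodMk hu)).congr ?_
  filter_upwards [ae_restrict_mem measurableSet_Icc] with t ht
  simp [projIcc_of_mem hT ht]

theorem exists_norm_le_of_continuousOn
    (hG : ContinuousOn (fun p : X × Y × ℝ => G p.1 p.2.1 p.2.2) (univ ×ˢ univ ×ˢ Icc 0 T))
    {B : Set X} (hB : IsCompact B) {U : Set Y} (hU : IsCompact U) :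
    ∃ M, ∀ x ∈ B, ∀ u ∈ U, ∀ t ∈ Icc 0 T, ‖G x u t‖ ≤ M := by
  obtain ⟨M, hM⟩ := (hB.prod (hU.prod isCompact_Icc)).exists_bound_of_continuousOn
    (hG.mono (prod_mono (subset_univ B) (prod_mono (subset_univ U) Subset.rfl)))
  exact ⟨M, fun x hx u hu t ht => hM (x, u, t) ⟨hx, hu, ht⟩⟩

theorem memLp_top_comp_of_continuousOn (hT : 0 ≤ T)
    (hG : ContinuousOn (fun p : X × Y × ℝ => G p.1 p.2.1 p.2.2) (univ ×ˢ univ ×ˢ Icc 0 T))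
    {U : Set Y} (hU : IsCompact U) {x : ℝ → X} (hx : ContinuousOn x (Icc 0 T)) {u : ℝ → Y}
    (hu : AEStronglyMeasurable u (volume.restrict (Icc 0 T)))
    (huU : ∀ᵐ t ∂volume.restrict (Icc 0 T), u t ∈ U) :
    MemLp (fun t => G (x t) (u t) t) ⊤ (volume.restrict (Icc 0 T)) := by
  obtain ⟨M, hM⟩ := exists_norm_le_of_continuousOn hG (isCompact_Icc.image_of_continuousOn hx) hU
  refine memLp_top_of_bound (aestronglyMeasurable_comp_of_continuousOn hT hG hx hu) M ?_
  filter_upwards [ae_restrict_mem measurableSet_Icc, huU] with t ht htU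
  exact hM _ (mem_image_of_mem x ht) _ htU _ ht

theorem exists_lipschitz_of_contDiffOn [NormedSpace ℝ X] [NormedSpace ℝ Y] [NormedSpace ℝ Z]
    (hG : ContDiffOn ℝ 1 (fun p : X × Y × ℝ => G p.1 p.2.1 p.2.2) (univ ×ˢ univ ×ˢ Icc 0 T))
    {B : Set X} (hB : IsCompact B) (hBc : Convex ℝ B) {U : Set Y} (hU : IsCompact U)
    (hUc : Convex ℝ U) :
    ∃ L : ℝ, ∀ x ∈ B, ∀ y ∈ B, ∀ u ∈ U, ∀ t ∈ Icc 0 T,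
      ‖G x u t - G y u t‖ ≤ L * ‖x - y‖ := by
  obtain ⟨L, hL⟩ := (hG.mono (prod_mono (subset_univ B) (prod_mono (subset_univ U)
    Subset.rfl))).exists_lipschitzOnWith one_ne_zero (hBc.prod (hUc.prod (convex_Icc 0 T)))
    (hB.prod (hU.prod isCompact_Icc))
  refine ⟨L, fun x hx y hy u hu t ht => ?_⟩
  have := hL.dist_le_mul (x, u, t) ⟨hx, hu, ht⟩ (y, u, t) ⟨hy, hu, ht⟩
  simpa [Prod.dist_eq, dist_eq_norm] using this

end Carath

/-! ### Cauchy problem and extended velocity set -/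

namespace ControlProblem

variable {n m : ℕ} {P : ControlProblem n m}

instance : IsFiniteMeasure P.μ := by unfold μ; infer_instance

theorem ae_iff_uIcc (hT : 0 ≤ P.T) {p : ℝ → Prop} :
    (∀ᵐ t ∂P.μ, p t) ↔ ∀ᵐ t, t ∈ uIcc 0 P.T → p t := by
  rw [uIcc_of_le hT, μ, ae_restrict_iff' measurableSet_Icc]

theorem intervalIntegrable_of_integrable (hT : 0 ≤ P.T) {E : Type*} [NormedAddCommGroup E]
    {g : ℝ → E} (hg : Integrable g P.μ) : IntervalIntegrable g volume 0 P.T :=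
  (intervalIntegrable_iff_integrableOn_Icc_of_le hT).2 hg

theorem intervalIntegral_eq_setIntegral {E : Type*} [NormedAddCommGroup E] [NormedSpace ℝ E]
    (g : ℝ → E) {t : ℝ} (ht : t ∈ Icc 0 P.T) :
    ∫ s in (0 : ℝ)..t, g s = ∫ s in Ioc 0 t, g s ∂P.μ := by
  rw [intervalIntegral.integral_of_le ht.1, μ, Measure.restrict_restrict measurableSet_Ioc,
    inter_eq_left.2 (Ioc_subset_Icc_self.trans (Icc_subset_Icc_right ht.2))]

theorem IsSolution.continuousOn (hT : 0 ≤ P.T) {u : ℝ → EuclideanSpace ℝ (Fin m)}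
    {x : ℝ → EuclideanSpace ℝ (Fin n)} (hx : P.IsSolution u x) : ContinuousOn x (Icc 0 P.T) := by
  simpa [uIcc_of_le hT] using hx.absCont.continuousOn

theorem IsSolution.eq_add_integral (hT : 0 ≤ P.T)
    {u : ℝ → EuclideanSpace ℝ (Fin m)} {x : ℝ → EuclideanSpace ℝ (Fin n)}
    (hx : P.IsSolution u x) (hb : MemLp (fun t => P.f (x t) (u t) t) ⊤ P.μ)
    {t : ℝ} (ht : t ∈ Icc 0 P.T) :
    x t = P.x₀ + ∫ s in (0 : ℝ)..t, P.f (x s) (u s) s := by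
  obtain ⟨M, hM⟩ : ∃ M, ∀ᵐ t ∂P.μ, ‖P.f (x t) (u t) t‖ ≤ M := by
    refine ⟨(eLpNorm (fun t => P.f (x t) (u t) t) ⊤ P.μ).toReal, ?_⟩
    rw [eLpNorm_exponent_top]
    filter_upwards [ae_le_eLpNormEssSup (μ := P.μ) (f := fun t => P.f (x t) (u t) t)] with t ht
    rw [← toReal_enorm]
    exact ENNReal.toReal_mono (by simpa using hb.2.ne) ht
  rw [← hx.init]
  exact hx.absCont.eq_add_integral ((ae_iff_uIcc hT).1 hx.ode)
    (intervalIntegrable_of_integrable hT (hb.integrable le_top)) ((ae_iff_uIcc hT).1 hM)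
    (by rwa [uIcc_of_le hT])

theorem IsSolution.eqOn (hT : 0 ≤ P.T) (hU : IsCompact P.U) (hUc : Convex ℝ P.U)
    (hf : ContDiffOn ℝ 1
      (fun p : EuclideanSpace ℝ (Fin n) × EuclideanSpace ℝ (Fin m) × ℝ =>
        P.f p.1 p.2.1 p.2.2) (univ ×ˢ univ ×ˢ Icc 0 P.T))
    {u : ℝ → EuclideanSpace ℝ (Fin m)} (hu : AEStronglyMeasurable u P.μ)
    (huU : ∀ᵐ t ∂P.μ, u t ∈ P.U) {x y : ℝ → EuclideanSpace ℝ (Fin n)}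
    (hx : P.IsSolution u x) (hy : P.IsSolution u y) : EqOn x y (Icc 0 P.T) := by
  have hxc := hx.continuousOn hT
  have hyc := hy.continuousOn hT
  have hfx := memLp_top_comp_of_continuousOn hT hf.continuousOn hU hxc hu huU
  have hfy := memLp_top_comp_of_continuousOn hT hf.continuousOn hU hyc hu huU
  -- One ball containing both trajectories supplies a single Lipschitz constant for `f`.
  obtain ⟨r, hr⟩ := ((isCompact_Icc.image_of_continuousOn hxc).union
    (isCompact_Icc.image_of_continuousOn hyc)).isBounded.subset_closedBall 0
  obtain ⟨L, hL⟩ := exists_lipschitz_of_contDiffOn hf (isCompact_closedBall 0 r)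
    (convex_closedBall 0 r) hU hUc
  have hd : ContinuousOn (fun t => ‖x t - y t‖) (Icc 0 P.T) := (hxc.sub hyc).norm
  intro t ht
  refine sub_eq_zero.1 (norm_eq_zero.1 (eq_zero_of_le_mul_integral (L := L) hT hd
    (fun _ _ => norm_nonneg _) (fun t ht => ?_) ht))
  have hix : IntegrableOn (fun s => P.f (x s) (u s) s) (Ioc 0 t) P.μ :=
    (hfx.integrable le_top).integrableOn
  have hiy : IntegrableOn (fun s => P.f (y s) (u s) s) (Ioc 0 t) P.μ :=
    (hfy.integrable le_top).integrableOn
  rw [hx.eq_add_integral hT hfx ht, hy.eq_add_integral hT hfy ht, add_sub_add_left_eq_sub,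
    intervalIntegral_eq_setIntegral _ ht, intervalIntegral_eq_setIntegral _ ht,
    intervalIntegral_eq_setIntegral _ ht, ← integral_sub hix hiy, ← integral_const_mul]
  refine norm_integral_le_of_norm_le ?_ (ae_restrict_of_ae ?_)
  · exact ((hd.integrableOn_compact isCompact_Icc).const_mul L).integrableOn
  · filter_upwards [huU, ae_restrict_mem measurableSet_Icc] with s h1 h2
    exact hL _ (hr (.inl (mem_image_of_mem x h2))) _ (hr (.inr (mem_image_of_mem y h2))) _ h1 _ h2

theorem isSolution_state {u : ℝ → EuclideanSpace ℝ (Fin m)}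
    (h : ∃ x, P.IsSolution u x) : P.IsSolution u (P.state u) := by
  rw [state, dif_pos h]
  exact h.choose_spec

open scoped Pointwise in
-- The set is the Minkowski sum of a compact set and a closed set.
theorem isClosed_extVelocity {d : ℕ}
    {F : EuclideanSpace ℝ (Fin n) → EuclideanSpace ℝ (Fin m) → ℝ → EuclideanSpace ℝ (Fin d)}
    {Λ : Set (EuclideanSpace ℝ (Fin d))} {x : EuclideanSpace ℝ (Fin n)} {t : ℝ}
    (hU : IsCompact P.U) (hf : Continuous fun u => P.f x u t) (hF : Continuous fun u => F x u t)
    (hΛ : IsClosed Λ) : IsClosed (P.extVelocity F Λ x t) := by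
  have hK := hU.image (hf.prodMk hF)
  have : P.extVelocity F Λ x t =
      ((fun u => (P.f x u t, F x u t)) '' P.U) + ({0} : Set (EuclideanSpace ℝ (Fin n))) ×ˢ Λ := by
    ext p
    simp only [extVelocity, mem_ofPred_eq, Set.mem_add, mem_image, mem_prod, mem_singleton_iff]
    constructor
    · rintro ⟨u, hu, l, hl, rfl⟩
      exact ⟨_, ⟨u, hu, rfl⟩, (0, l), ⟨rfl, hl⟩, by simp⟩
    · rintro ⟨_, ⟨u, hu, rfl⟩, ⟨z, l⟩, ⟨hz, hl⟩, rfl⟩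
      simp only at hz hl
      exact ⟨u, hu, l, hl, by simp [hz]⟩
  rw [this]
  exact (isClosed_singleton.prod hΛ).add_left_of_isCompact hK

end ControlProblem

/-! ### Filippov selection and thickened velocity sets -/

namespace ControlProblem

variable {n m d : ℕ} {P : ControlProblem n m}

theorem exists_measurable_control (hT : 0 ≤ P.T) (hU : IsCompact P.U) (hUne : P.U.Nonempty)
    (hf : ContinuousOn
      (fun p : EuclideanSpace ℝ (Fin n) × EuclideanSpace ℝ (Fin m) × ℝ =>
        P.f p.1 p.2.1 p.2.2) (univ ×ˢ univ ×ˢ Icc 0 P.T))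
    {F : EuclideanSpace ℝ (Fin n) → EuclideanSpace ℝ (Fin m) → ℝ → EuclideanSpace ℝ (Fin d)}
    (hF : ContinuousOn
      (fun p : EuclideanSpace ℝ (Fin n) × EuclideanSpace ℝ (Fin m) × ℝ =>
        F p.1 p.2.1 p.2.2) (univ ×ˢ univ ×ˢ Icc 0 P.T))
    {Λ : Set (EuclideanSpace ℝ (Fin d))} (hΛ : IsClosed Λ)
    {x : ℝ → EuclideanSpace ℝ (Fin n)} (hx : ContinuousOn x (Icc 0 P.T))
    {v : ℝ → EuclideanSpace ℝ (Fin n)} (hv : Measurable v)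
    {w : ℝ → EuclideanSpace ℝ (Fin d)} (hw : Measurable w)
    (hvw : ∀ᵐ t ∂P.μ, (v t, w t) ∈ P.extVelocity F Λ (x t) t) :
    ∃ u : ℝ → EuclideanSpace ℝ (Fin m), Measurable u ∧ (∀ t, u t ∈ P.U) ∧
      ∀ᵐ t ∂P.μ, P.f (x t) (u t) t = v t ∧ w t - F (x t) (u t) t ∈ Λ := by
  classical
  have hgood := hvw.and (ae_restrict_mem (μ := volume) (measurableSet_Icc (a := 0) (b := P.T)))
  -- Removing a measurable hull of the exceptional null set leaves a measurable set on which the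
  -- inclusion holds at every point.
  let A : Set ℝ := (toMeasurable P.μ
    {t | ¬ ((v t, w t) ∈ P.extVelocity F Λ (x t) t ∧ t ∈ Icc 0 P.T)})ᶜ
  have hA : MeasurableSet A := (measurableSet_toMeasurable _ _).compl
  have hAae : ∀ᵐ t ∂P.μ, t ∈ A := by
    rw [ae_iff]
    simpa [A, measure_toMeasurable] using ae_iff.1 hgood
  have hAg : ∀ t ∈ A, (v t, w t) ∈ P.extVelocity F Λ (x t) t ∧ t ∈ Icc 0 P.T := fun t ht => by
    by_contra h
    exact ht (subset_toMeasurable _ _ h)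
  let p : ℝ → ℝ := fun t => projIcc 0 P.T hT t
  have hp : ∀ t ∈ A, p t = t := fun t ht => by simp [p, projIcc_of_mem hT (hAg t ht).2]
  have hfc := continuous_comp_projIcc hT hf hx
  have hFc := continuous_comp_projIcc hT hF hx
  -- Zeros of `g t` on `A` are exactly the controls realising `(v t, w t)`; off `A` every control is
  -- a zero.
  let g : ℝ → EuclideanSpace ℝ (Fin m) → ℝ := fun t u =>
    A.indicator (fun t => ‖P.f (x (p t)) u (p t) - v t‖ +
      Metric.infDist (w t - F (x (p t)) u (p t)) Λ) t
  obtain ⟨s, hs, hsU⟩ := hU.exists_measurable_zero hUne (g := g)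
    (fun u _ => by
      have h1 : Measurable fun t => P.f (x (p t)) u (p t) :=
        (hfc.comp (continuous_id.prodMk continuous_const)).measurable
      have h2 : Measurable fun t => F (x (p t)) u (p t) :=
        (hFc.comp (continuous_id.prodMk continuous_const)).measurable
      exact ((h1.sub hv).norm.add (hw.sub h2).infDist).indicator hA)
    (fun t => by
      by_cases ht : t ∈ A
      · have h1 : Continuous fun u => P.f (x (p t)) u (p t) :=
          hfc.comp (continuous_const.prodMk continuous_id)
        have h2 : Continuous fun u => F (x (p t)) u (p t) :=
          hFc.comp (continuous_const.prodMk continuous_id)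
        simp only [g, indicator_of_mem ht]
        exact ((h1.sub continuous_const).norm.add ((Metric.continuous_infDist_pt Λ).comp
          (continuous_const.sub h2))).continuousOn
      · simp only [g, indicator_of_notMem ht]
        exact continuousOn_const)
    (fun t u _ => indicator_nonneg (fun _ _ => add_nonneg (norm_nonneg _) Metric.infDist_nonneg) _)
    (fun t => by
      by_cases ht : t ∈ A
      · obtain ⟨u, hu, l, hl, h⟩ := (hAg t ht).1
        obtain ⟨h1, h2⟩ := Prod.mk.inj h
        refine ⟨u, hu, ?_⟩
        simp only [g, indicator_of_mem ht, hp t ht, h1, h2, sub_self, norm_zero,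
          add_sub_cancel_left, zero_add]
        exact Metric.infDist_zero_of_mem hl
      · obtain ⟨u, hu⟩ := hUne
        exact ⟨u, hu, indicator_of_notMem ht _⟩)
  refine ⟨s, hs, fun t => (hsU t).1, ?_⟩
  filter_upwards [hAae] with t ht
  have h0 := (hsU t).2
  simp only [g, indicator_of_mem ht, hp t ht] at h0
  obtain ⟨h1, h2⟩ := (add_eq_zero_iff_of_nonneg (norm_nonneg _) Metric.infDist_nonneg).1 h0
  obtain ⟨_, _, l, hl, _⟩ := (hAg t ht).1
  exact ⟨sub_eq_zero.1 (norm_eq_zero.1 h1), (hΛ.mem_iff_infDist_zero ⟨l, hl⟩).2 h2⟩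

theorem eventually_mem_cthickening_extVelocity (hU : IsCompact P.U)
    (hf : ContinuousOn
      (fun p : EuclideanSpace ℝ (Fin n) × EuclideanSpace ℝ (Fin m) × ℝ =>
        P.f p.1 p.2.1 p.2.2) (univ ×ˢ univ ×ˢ Icc 0 P.T))
    {F : EuclideanSpace ℝ (Fin n) → EuclideanSpace ℝ (Fin m) → ℝ → EuclideanSpace ℝ (Fin d)}
    (hF : ContinuousOn
      (fun p : EuclideanSpace ℝ (Fin n) × EuclideanSpace ℝ (Fin m) × ℝ =>
        F p.1 p.2.1 p.2.2) (univ ×ˢ univ ×ˢ Icc 0 P.T))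
    {Λ : Set (EuclideanSpace ℝ (Fin d))} (hΛ : 0 ∈ Λ) {R : ℝ}
    {x : ℕ → ℝ → EuclideanSpace ℝ (Fin n)} {y : ℝ → EuclideanSpace ℝ (Fin n)}
    (hx : ∀ k, ∀ t ∈ Icc 0 P.T, ‖x k t‖ ≤ R) (hxy : TendstoUniformlyOn x y atTop (Icc 0 P.T))
    {ε : ℝ} (hε : 0 < ε) :
    ∀ᶠ k in atTop, ∀ t ∈ Icc 0 P.T, ∀ u ∈ P.U,
      (P.f (x k t) u t, F (x k t) u t) ∈ Metric.cthickening ε (P.extVelocity F Λ (y t) t) := by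
  have hy : ∀ t ∈ Icc 0 P.T, ‖y t‖ ≤ R := fun t ht =>
    le_of_tendsto (hxy.tendsto_at ht).norm (Eventually.of_forall fun k => hx k t ht)
  have hS := ((isCompact_closedBall (0 : EuclideanSpace ℝ (Fin n)) R).prod
    (hU.prod (isCompact_Icc (a := 0) (b := P.T)))).uniformContinuousOn_of_continuous
    ((hf.prodMk hF).mono (prod_mono (subset_univ _) (prod_mono (subset_univ _) Subset.rfl)))
  obtain ⟨δ, hδ, h⟩ := Metric.uniformContinuousOn_iff.1 hS ε hε
  filter_upwards [Metric.tendstoUniformlyOn_iff.1 hxy δ hδ] with k hk t ht u hu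
  -- The nearby point keeps the same control at the limit state, with slack 0 ∈ Λ.
  refine Metric.mem_cthickening_of_dist_le _ (P.f (y t) u t, F (y t) u t) _ _
    ⟨u, hu, 0, hΛ, by simp⟩ ?_
  refine (h (x k t, u, t) ⟨by simpa using hx k t ht, hu, ht⟩ (y t, u, t)
    ⟨by simpa using hy t ht, hu, ht⟩ ?_).le
  have := hk t ht
  rw [dist_comm] at this
  simpa [Prod.dist_eq] using this

end ControlProblem

/-! ### The compactness theorem -/

theorem lemma5 {n m d : ℕ} (hn : 0 < n) (hm : 0 < m) (hd : 0 < d)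
    (P : ControlProblem n m) (hT : 0 < P.T)
    (hU_ne : P.U.Nonempty) (hU_closed : IsClosed P.U) (hU_convex : Convex ℝ P.U)
    (hf : ContDiffOn ℝ 2
      (fun p : EuclideanSpace ℝ (Fin n) × EuclideanSpace ℝ (Fin m) × ℝ =>
        P.f p.1 p.2.1 p.2.2) (univ ×ˢ univ ×ˢ Icc 0 P.T))
    (F : EuclideanSpace ℝ (Fin n) → EuclideanSpace ℝ (Fin m) → ℝ → EuclideanSpace ℝ (Fin d))
    (hF_cont : ContinuousOn
      (fun p : EuclideanSpace ℝ (Fin n) × EuclideanSpace ℝ (Fin m) × ℝ =>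
        F p.1 p.2.1 p.2.2) (univ ×ˢ univ ×ˢ Icc 0 P.T))
    (hF_diff : ∀ x u, ∀ t ∈ Icc 0 P.T, DifferentiableAt ℝ (fun y => F y u t) x)
    (hF_grad : ContinuousOn
      (fun p : EuclideanSpace ℝ (Fin n) × EuclideanSpace ℝ (Fin m) × ℝ =>
        fderiv ℝ (fun y => F y p.2.1 p.2.2) p.1) (univ ×ˢ univ ×ˢ Icc 0 P.T))
    (Λ : Set (EuclideanSpace ℝ (Fin d))) (hΛ_closed : IsClosed Λ) (hΛ_zero : 0 ∈ Λ)
    (hA : ∃ x u, P.IsAdmissiblePair x u)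
    (hcomp : P.HComp)
    (hconv : ∀ x, ∀ t ∈ Icc 0 P.T, Convex ℝ (P.extVelocity F Λ x t))
    (u : ℕ → ℝ → EuclideanSpace ℝ (Fin m)) (hu : ∀ k, u k ∈ P.AdmControls) :
    ∃ φ : ℕ → ℕ, StrictMono φ ∧
      ∃ ubar ∈ P.AdmControls, ∃ lbar : ℝ → EuclideanSpace ℝ (Fin d),
        MemLp lbar ⊤ P.μ ∧ (∀ᵐ t ∂P.μ, lbar t ∈ Λ) ∧
        TendstoUniformlyOn (fun k => P.state (u (φ k))) (P.state ubar) atTop (Icc 0 P.T) ∧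
        P.WeakStarTendsto (fun k t => P.f (P.state (u (φ k)) t) (u (φ k) t) t)
          (fun t => P.f (P.state ubar t) (ubar t) t) ∧
        P.WeakStarTendsto (fun k t => F (P.state (u (φ k)) t) (u (φ k) t) t)
          (fun t => F (P.state ubar t) (ubar t) t + lbar t) := by

  have hT' := hT.le
  have : Fact ((2 : ENNReal) ≠ ⊤) := ⟨ENNReal.ofNat_ne_top⟩
  obtain ⟨hU, R, -, hR⟩ := hcomp
  have hf1 := hf.of_le (show (1 : WithTop ℕ∞) ≤ 2 by norm_num)
  have hfc := hf.continuousOn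
  set x : ℕ → ℝ → EuclideanSpace ℝ (Fin n) := fun k => P.state (u k) with hx
  have hsol : ∀ k, P.IsSolution (u k) (x k) := fun k => (hu k).2.sol
  have hxR : ∀ k, ∀ t ∈ Icc 0 P.T, ‖x k t‖ ≤ R := fun k => hR _ _ (hu k).2
  have hxc : ∀ k, ContinuousOn (x k) (Icc 0 P.T) := fun k => (hsol k).continuousOn hT'
  have huU : ∀ k, ∀ᵐ t ∂P.μ, u k t ∈ P.U := fun k => (hu k).2.mem_U
  have hg : ∀ k, MemLp (fun t => P.f (x k t) (u k t) t) ⊤ P.μ := fun k =>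
    memLp_top_comp_of_continuousOn hT' hfc hU (hxc k) (hu k).2.memLp.1 (huU k)
  have hh : ∀ k, MemLp (fun t => F (x k t) (u k t) t) ⊤ P.μ := fun k =>
    memLp_top_comp_of_continuousOn hT' hF_cont hU (hxc k) (hu k).2.memLp.1 (huU k)
  have hg2 : ∀ k, MemLp (fun t => P.f (x k t) (u k t) t) 2 P.μ := fun k => (hg k).mono_exponent le_top
  have hh2 : ∀ k, MemLp (fun t => F (x k t) (u k t) t) 2 P.μ := fun k => (hh k).mono_exponent le_top
  obtain ⟨M, hM⟩ := exists_norm_le_of_continuousOn hfc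
    (isCompact_closedBall (0 : EuclideanSpace ℝ (Fin n)) R) hU
  obtain ⟨N, hN⟩ := exists_norm_le_of_continuousOn hF_cont
    (isCompact_closedBall (0 : EuclideanSpace ℝ (Fin n)) R) hU
  have hgM : ∀ k, ∀ᵐ t ∂P.μ, ‖P.f (x k t) (u k t) t‖ ≤ M := fun k => by
    filter_upwards [huU k, ae_restrict_mem measurableSet_Icc] with t h1 h2
    exact hM _ (by simpa using hxR k t h2) _ h1 _ h2
  have hhN : ∀ k, ∀ᵐ t ∂P.μ, ‖F (x k t) (u k t) t‖ ≤ N := fun k => by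
    filter_upwards [huU k, ae_restrict_mem measurableSet_Icc] with t h1 h2
    exact hN _ (by simpa using hxR k t h2) _ h1 _ h2
  obtain ⟨φ, hφ, v, hv⟩ := exists_subseq_tendsto_weak (fun k => (hg2 k).toLp)
    (fun k => Lp.norm_le_of_ae_bound (C := |M|) (abs_nonneg M) (by
      filter_upwards [hgM k, (hg2 k).coeFn_toLp] with t h1 h2
      rw [h2]
      exact h1.trans (le_abs_self M)))
  obtain ⟨ψ, hψ, w, hw⟩ := exists_subseq_tendsto_weak (fun k => (hh2 (φ k)).toLp)
    (fun k => Lp.norm_le_of_ae_bound (C := |N|) (abs_nonneg N) (by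
      filter_upwards [hhN (φ k), (hh2 (φ k)).coeFn_toLp] with t h1 h2
      rw [h2]
      exact h1.trans (le_abs_self N)))
  have hv' : ∀ ℓ : Lp (EuclideanSpace ℝ (Fin n)) 2 P.μ →L[ℝ] ℝ,
      Tendsto (fun k => ℓ (hg2 (φ (ψ k))).toLp) atTop (𝓝 (ℓ v)) := fun ℓ =>
    (hv ℓ).comp hψ.tendsto_atTop
  have hvM := ae_norm_le_of_tendsto_weak (fun k => hg2 (φ (ψ k))) hv' (fun k => hgM _)
  have hwN := ae_norm_le_of_tendsto_weak (fun k => hh2 (φ (ψ k))) hw (fun k => hhN _)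
  have hgw := fun (η : ℝ → EuclideanSpace ℝ (Fin n)) (hη : Integrable η P.μ) =>
    tendsto_integral_inner_of_tendsto_weak (fun k => hg2 (φ (ψ k))) hv' (fun k => hgM _) hη
  have hhw := fun (η : ℝ → EuclideanSpace ℝ (Fin d)) (hη : Integrable η P.μ) =>
    tendsto_integral_inner_of_tendsto_weak (fun k => hh2 (φ (ψ k))) hw (fun k => hhN _) hη
  have hvi : Integrable v P.μ := (Lp.memLp v).integrable one_le_two
  have hvI := ControlProblem.intervalIntegrable_of_integrable hT' hvi
  have hvM' := (ControlProblem.ae_iff_uIcc hT').1 hvM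
  -- Candidate limit state: the primitive of the weak limit of the velocities.
  let y : ℝ → EuclideanSpace ℝ (Fin n) := fun t => P.x₀ + ∫ s in (0 : ℝ)..t, v s
  have hyAC : AbsolutelyContinuousOnInterval y 0 P.T := by
    refine AbsolutelyContinuousOnInterval.add (f := fun _ => P.x₀) ?_
      (absolutelyContinuousOnInterval_intervalIntegral_of_bounded hvI hvM')
    exact (LipschitzWith.const P.x₀).lipschitzOnWith.absolutelyContinuousOnInterval
  have hyc : ContinuousOn y (Icc 0 P.T) := by simpa [uIcc_of_le hT'] using hyAC.continuousOn
  have hyd : ∀ᵐ t ∂P.μ, HasDerivAt y (v t) t := by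
    rw [ControlProblem.ae_iff_uIcc hT']
    filter_upwards [hvI.ae_hasDerivAt_integral] with t ht ht'
    exact (ht ht' 0 left_mem_uIcc).const_add _
  have hxint : ∀ k, ∀ t ∈ Icc 0 P.T,
      x k t = P.x₀ + ∫ s in (0 : ℝ)..t, P.f (x k s) (u k s) s := fun k t ht =>
    (hsol k).eq_add_integral hT' (hg k) ht
  have hxy : TendstoUniformlyOn (fun k => x (φ (ψ k))) y atTop (Icc 0 P.T) := by
    refine tendstoUniformlyOn_of_norm_sub_le isCompact_Icc (M := M) (fun k s hs t ht => ?_)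
      (fun t ht => ?_)
    · rw [hxint _ t ht, hxint _ s hs, add_sub_add_left_eq_sub]
      rw [← uIcc_of_le hT'] at hs ht
      exact norm_intervalIntegral_sub_le (ControlProblem.intervalIntegrable_of_integrable hT'
        ((hg _).integrable le_top)) ((ControlProblem.ae_iff_uIcc hT').1 (hgM _)) hs ht
    -- Weak convergence tested on indicators of `(0, t]`.
    · simp only [y, hxint _ t ht, ControlProblem.intervalIntegral_eq_setIntegral _ ht]
      exact (tendsto_setIntegral_of_tendsto_integral_inner
        (fun k => (hg (φ (ψ k))).integrable le_top) hvi hgw measurableSet_Ioc).const_add _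
  have hyT : y P.T = P.xT := by
    refine tendsto_nhds_unique (hxy.tendsto_at (right_mem_Icc.2 hT')) ?_
    simp only [hx, (hu _).2.final]
    exact tendsto_const_nhds
  have hcl : ∀ t ∈ Icc 0 P.T, IsClosed (P.extVelocity F Λ (y t) t) := fun t ht =>
    ControlProblem.isClosed_extVelocity hU
      (hfc.comp_continuous (f := fun a => (y t, a, t)) (by fun_prop)
        fun a => ⟨mem_univ _, mem_univ _, ht⟩)
      (hF_cont.comp_continuous (f := fun a => (y t, a, t)) (by fun_prop)
        fun a => ⟨mem_univ _, mem_univ _, ht⟩) hΛ_closed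
  -- Countably many radii, so the exceptional null sets can be united before letting the radius tend
  -- to 0.
  have hthick : ∀ j : ℕ, ∀ᵐ t ∂P.μ,
      (v t, w t) ∈ Metric.cthickening (1 / ((j : ℝ) + 1)) (P.extVelocity F Λ (y t) t) := by
    intro j
    refine ae_mem_of_tendsto_weak_prod ?_ (ae_of_all _ fun t => Metric.isClosed_cthickening)
      (fun k => hg2 (φ (ψ k))) (fun k => hh2 (φ (ψ k))) hv' hw ?_
    · filter_upwards [ae_restrict_mem measurableSet_Icc] with t ht
      exact (hconv _ t ht).cthickening _
    · filter_upwards [ControlProblem.eventually_mem_cthickening_extVelocity hU hfc hF_cont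
        hΛ_zero (fun k => hxR (φ (ψ k))) hxy (Nat.one_div_pos_of_nat (α := ℝ) (n := j))] with k hk
      filter_upwards [huU (φ (ψ k)), ae_restrict_mem measurableSet_Icc] with t h1 h2
      exact hk t h2 _ h1
  have hvw : ∀ᵐ t ∂P.μ, (v t, w t) ∈ P.extVelocity F Λ (y t) t := by
    filter_upwards [ae_all_iff.2 hthick, ae_restrict_mem measurableSet_Icc] with t h1 h2
    rw [← (hcl t h2).closure_eq, Metric.closure_eq_iInter_cthickening' _
      (range fun j : ℕ => 1 / ((j : ℝ) + 1)) ?_]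
    · simpa using h1
    · intro ε hε
      obtain ⟨j, hj⟩ := exists_nat_one_div_lt hε
      exact ⟨_, mem_range_self j, Nat.one_div_pos_of_nat, hj.le⟩
  obtain ⟨a, ham, haU, ha⟩ := ControlProblem.exists_measurable_control hT' hU hU_ne hfc hF_cont
    hΛ_closed hyc (Lp.stronglyMeasurable v).measurable (Lp.stronglyMeasurable w).measurable hvw
  have haU' : ∀ᵐ t ∂P.μ, a t ∈ P.U := ae_of_all _ haU
  have hysol : P.IsSolution a y := by
    refine ⟨hyAC, ?_, by simp [y]⟩
    filter_upwards [hyd, ha] with t h1 h2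
    rwa [h2.1]
  have haLp : MemLp a ⊤ P.μ := by
    obtain ⟨C, hC⟩ := hU.isBounded.exists_norm_le
    exact memLp_top_of_bound ham.aestronglyMeasurable C (ae_of_all _ fun t => hC _ (haU t))
  have huniq : ∀ z, P.IsSolution a z → EqOn z y (Icc 0 P.T) := fun z hz =>
    hz.eqOn hT' hU hU_convex hf1 ham.aestronglyMeasurable haU' hysol
  have hst := ControlProblem.isSolution_state ⟨y, hysol⟩
  -- `P.state a` is an arbitrarily chosen solution, so it is compared with `y` on [0, T] only.
  have hsy := huniq _ hst
  have haAdm : a ∈ P.AdmControls :=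
    ⟨⟨haLp.mono_exponent le_top, y, hysol, huniq⟩,
      haLp, haU', hst, (hsy (right_mem_Icc.2 hT')).trans hyT⟩
  have hsv : ∀ᵐ t ∂P.μ, P.f (P.state a t) (a t) t = v t := by
    filter_upwards [ha, ae_restrict_mem measurableSet_Icc] with t h1 h2
    rw [hsy h2, h1.1]
  have hFy := memLp_top_comp_of_continuousOn hT' hF_cont hU hyc
    ham.aestronglyMeasurable haU'
  have hwLp : MemLp w ⊤ P.μ := memLp_top_of_bound (Lp.aestronglyMeasurable w) N hwN
  have hvLp : MemLp v ⊤ P.μ := memLp_top_of_bound (Lp.aestronglyMeasurable v) M hvM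
  have hsw : ∀ᵐ t ∂P.μ, F (P.state a t) (a t) t + (w t - F (y t) (a t) t) = w t := by
    filter_upwards [ae_restrict_mem measurableSet_Icc] with t h2
    rw [hsy h2]
    abel
  refine ⟨φ ∘ ψ, hφ.comp hψ, a, haAdm, fun t => w t - F (y t) (a t) t, hwLp.sub hFy,
    ha.mono fun t ht => ht.2, hxy.congr_right fun t ht => (hsy ht).symm,
    ⟨fun k => hg _, (memLp_congr_ae hsv).2 hvLp, fun η hη => ?_⟩,
    ⟨fun k => hh _, (memLp_congr_ae hsw).2 hwLp, fun η hη => ?_⟩⟩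
  · rw [integral_congr_ae (hsv.mono fun t ht => congrArg (inner ℝ · (η t)) ht)]
    exact hgw η hη
  · rw [integral_congr_ae (hsw.mono fun t ht => congrArg (inner ℝ · (η t)) ht)]
    exact hhw η hη
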